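/- \textbf{Maximum principle for basic maps.} Let $M$ be a compact smooth manifold with a K\"ahler foliation $(\mathcal F,g_Q,J)$ of leaf dimension $m$ and complex codimension $n$: that is, $\mathcal F$ is a foliation with tangent distribution $L\subset TM$, $g_Q$ is a metric and $J$ an endomorphism of the normal bundle $Q=TM/L$ with $J^2=-\mathrm{Id}$ and $g_Q(J\cdot,J\cdot)=g_Q$, and around every point there are foliated coordinates $(x,z)\in\mathbb R^m\times\mathbb C^n$ (with $L=\ker dz$) in which $J$ is multiplication by $i$ and $g_Q$ is the pull-back of a K\"ahler metric in the variables $z$ (\emph{complex foliated coordinates} are those in which $L=\ker dz$ and $J$ is multiplication by $i$). Let $0<\epsilon\le\infty$. A smooth function $u$ on $M$ is \emph{basic} if $du|_L=0$; $C^\infty_B(M)$ denotes the space of real basic functions, and $C^\infty_B(M\times[0,\epsilon))$ the space of real smooth functions on $M\times[0,\epsilon)$ that are basic for each $t$. For $u\in C^\infty_B(M)$ and $p\in M$, write $i\partial_B\bar\partial_B u(p)\le 0$ if the Hermitian matrix $\big(\partial^2u/\partial z_k\partial\bar z_l\big)$ in complex foliated coordinates is negative semidefinite at $p$. Let $E(\cdot,t)\colon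 C^\infty_B(M)\to C^\infty_B(M)$, $t\in[0,\epsilon)$, be a smooth family of linear basic partial differential operators of order $r$, i.e. in real foliated coordinates $(x,y)\in\mathbb R^m\times\mathbb R^{2n}$ (with $L=\ker dy$ and connected plaques $y=\mathrm{const}$), $$E(u,t)=\sum_{k\le r}\ \sum_{i_1,\dots,i_k}a^{i_1\cdots i_k}(y,t)\,\frac{\partial^k u}{\partial y^{i_1}\cdots\partial y^{i_k}}$$ with coefficients smooth in $(y,t)$. Assume that for every $t\in[0,\epsilon)$ the operator $E(\cdot,t)$ is transversally strongly elliptic: $r$ is even and there is $\lambda>0$ (which may depend on $t$) such that $\sum a^{i_1\cdots i_r}(y,t)\,\xi_{i_1}\cdots\xi_{i_r}\ge\lambda|\xi|_{g_Q}^r$ in all such foliated coordinates, at all points of $M$ and for all non-zero $\xi=\sum\xi_i\,dy^i\in Q^*$. Assume moreover that for every $h\in C^\infty_B(M\times[0,\epsilon))$ and every $(p,t)\in M\times[0,\epsilon)$, $$i\partial_B\bar\partial_B h(\cdot,t)(p)\le 0\ \Longrightarrow\ E(h(\cdot,t),t)(p)\le 0 .$$ If $h\in C^\infty_B(M\times[0,\epsilon))$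 satisfies $\partial_th(p,t)-E(h(\cdot,t),t)(p)\le 0$ for all $(p,t)\in M\times[0,\epsilon)$, then $$\sup_{(p,t)\in M\times[0,\epsilon)}h(p,t)\ \le\ \sup_{p\in M}h(p,0).$$ -/

import Mathlib

open scoped Manifold ContDiff ComplexOrder

noncomputable section

/-- The manifold `M` below has dimension `m + q`; its leaves have dimension `m`, codimension `q`. -/
abbrev ManifoldModel (m q : ℕ) : Type := EuclideanSpace ℝ (Fin (m + q))

/-- The transverse part `y` of local coordinates `(x, y)`. -/
def transverseCoord {M W V : Type*} [TopologicalSpace M] [TopologicalSpace W] [TopologicalSpace V]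
    (e : OpenPartialHomeomorph M (W × V)) : M → V :=
  fun p => (e p).2

/-- The differential `dy` of the transverse coordinates at `p`. -/
def dTransverse {m q : ℕ} {M W V : Type*} [TopologicalSpace M]
    [ChartedSpace (ManifoldModel m q) M]
    [NormedAddCommGroup W] [NormedAddCommGroup V] [NormedSpace ℝ V]
    (e : OpenPartialHomeomorph M (W × V)) (p : M) :
    TangentSpace 𝓘(ℝ, ManifoldModel m q) p →L[ℝ] V :=
  mfderiv 𝓘(ℝ, ManifoldModel m q) 𝓘(ℝ, V) (transverseCoord e) p

/-- Foliated coordinates `(x, y)` for a distribution `L`: smooth coordinates in which `L` is the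
kernel of `dy` and the plaques `y = const` are connected. -/
structure IsFoliatedChart {m q : ℕ} {M W V : Type*} [TopologicalSpace M]
    [ChartedSpace (ManifoldModel m q) M]
    [NormedAddCommGroup W] [NormedSpace ℝ W] [NormedAddCommGroup V] [NormedSpace ℝ V]
    (L : (p : M) → Submodule ℝ (TangentSpace 𝓘(ℝ, ManifoldModel m q) p))
    (e : OpenPartialHomeomorph M (W × V)) : Prop where
  smooth : ContMDiffOn 𝓘(ℝ, ManifoldModel m q) 𝓘(ℝ, W × V) ∞ e e.source
  smooth_symm : ContMDiffOn 𝓘(ℝ, W × V) 𝓘(ℝ, ManifoldModel m q) ∞ e.symm e.target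
  tangent_eq : ∀ p ∈ e.source, ∀ v : TangentSpace 𝓘(ℝ, ManifoldModel m q) p,
    v ∈ L p ↔ dTransverse e p v = 0
  plaque_connected : ∀ y : V, IsPreconnected {w : W | (w, y) ∈ e.target}

/-- A foliation with leaves of dimension `m` and codimension `q`: a distribution `L` with foliated
coordinates valued in `ℝ^m × ℝ^q` around every point. -/
structure Foliation (m q : ℕ) (M : Type*) [TopologicalSpace M]
    [ChartedSpace (ManifoldModel m q) M] where
  /-- the tangent distribution of the foliation -/
  L : (p : M) → Submodule ℝ (TangentSpace 𝓘(ℝ, ManifoldModel m q) p)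
  exists_chart : ∀ p : M,
    ∃ e : OpenPartialHomeomorph M (EuclideanSpace ℝ (Fin m) × EuclideanSpace ℝ (Fin q)),
      IsFoliatedChart L e ∧ p ∈ e.source

namespace Foliation

variable {m q : ℕ} {M : Type*} [TopologicalSpace M] [ChartedSpace (ManifoldModel m q) M]

/-- The normal bundle `Q = TM / L`. -/
abbrev Q (F : Foliation m q M) (p : M) : Type :=
  TangentSpace 𝓘(ℝ, ManifoldModel m q) p ⧸ F.L p

/-- The class in `Q` of a tangent vector. -/
def toQ (F : Foliation m q M) (p : M) :
    TangentSpace 𝓘(ℝ, ManifoldModel m q) p →ₗ[ℝ] F.Q p :=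
  (F.L p).mkQ

/-- The space `C_B^∞(M)` of smooth functions whose differential vanishes along the leaves. -/
def basicFunctions (F : Foliation m q M) : Submodule ℝ (M → ℝ) where
  carrier := {u | ContMDiff 𝓘(ℝ, ManifoldModel m q) 𝓘(ℝ, ℝ) ∞ u ∧
    ∀ p : M, ∀ v ∈ F.L p, mfderiv 𝓘(ℝ, ManifoldModel m q) 𝓘(ℝ, ℝ) u p v = 0}
  zero_mem' := by
    refine ⟨contMDiff_const, fun p v _ => ?_⟩
    have : mfderiv 𝓘(ℝ, ManifoldModel m q) 𝓘(ℝ, ℝ) (0 : M → ℝ) p = 0 := mfderiv_const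
    rw [this]; rfl
  add_mem' := by
    rintro u w ⟨hu, hu'⟩ ⟨hw, hw'⟩
    refine ⟨hu.add hw, fun p v hv => ?_⟩
    have h := mfderiv_add (hu.mdifferentiable (by simp) p) (hw.mdifferentiable (by simp) p)
    have h1 := congrArg (fun T => T v) h
    refine h1.trans ?_
    exact (congrArg₂ (fun a b : ℝ => a + b) (hu' p v hv) (hw' p v hv)).trans (add_zero 0)
  smul_mem' := by
    rintro c u ⟨hu, hu'⟩
    refine ⟨((contDiff_const_smul c).contMDiff).comp hu, fun p v hv => ?_⟩
    have h := const_smul_mfderiv (hu.mdifferentiable (by simp) p) c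
    have h1 := congrArg (fun T => T v) h
    refine h1.trans ?_
    exact (congrArg (fun a : ℝ => c • a) (hu' p v hv)).trans (smul_zero c)

end Foliation

/-- `g` is a Kähler metric on the open set `O` of `ℂ^n` with its standard complex structure: a
smooth Hermitian Riemannian metric whose fundamental form `ω(v, w) = g(iv, w)` is closed. -/
structure IsKaehlerMetricOn {n : ℕ}
    (g : EuclideanSpace ℂ (Fin n) →
      EuclideanSpace ℂ (Fin n) →L[ℝ] EuclideanSpace ℂ (Fin n) →L[ℝ] ℝ)
    (O : Set (EuclideanSpace ℂ (Fin n))) : Prop where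
  smooth : ContDiffOn ℝ ∞ g O
  symm : ∀ z ∈ O, ∀ v w, g z v w = g z w v
  pos : ∀ z ∈ O, ∀ v, v ≠ 0 → 0 < g z v v
  hermitian : ∀ z ∈ O, ∀ v w, g z (Complex.I • v) (Complex.I • w) = g z v w
  closed : ∀ z ∈ O, ∀ u v w,
    fderiv ℝ g z u (Complex.I • v) w + fderiv ℝ g z v (Complex.I • w) u
      + fderiv ℝ g z w (Complex.I • u) v = 0

/-- Complex foliated coordinates `(x, z)` for a foliation with an endomorphism `J` of `Q`:
foliated coordinates in which `J` is multiplication by `i` in `z`. -/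
structure IsComplexFoliatedChart {m n : ℕ} {M : Type*} [TopologicalSpace M]
    [ChartedSpace (ManifoldModel m (2 * n)) M] (F : Foliation m (2 * n) M)
    (J : (p : M) → F.Q p →ₗ[ℝ] F.Q p)
    (e : OpenPartialHomeomorph M (EuclideanSpace ℝ (Fin m) × EuclideanSpace ℂ (Fin n))) :
    Prop where
  foliated : IsFoliatedChart F.L e
  map_J : ∀ p ∈ e.source, ∀ v w : TangentSpace 𝓘(ℝ, ManifoldModel m (2 * n)) p,
    J p (F.toQ p v) = F.toQ p w → dTransverse e p w = Complex.I • dTransverse e p v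

/-- A transverse Kähler structure `(g_Q, J)`: around every point there are complex foliated
coordinates `(x, z)` (integrability of `J`) in which `g_Q` is the pull-back of a Kähler metric in
the variables `z` (so `g_Q` is holonomy invariant and its fundamental form is closed). -/
structure TransverseKaehler {m n : ℕ} {M : Type*} [TopologicalSpace M]
    [ChartedSpace (ManifoldModel m (2 * n)) M] (F : Foliation m (2 * n) M) where
  gQ : (p : M) → F.Q p →ₗ[ℝ] F.Q p →ₗ[ℝ] ℝ
  J : (p : M) → F.Q p →ₗ[ℝ] F.Q p
  gQ_symm : ∀ p v w, gQ p v w = gQ p w v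
  gQ_pos : ∀ p v, v ≠ 0 → 0 < gQ p v v
  J_sq : ∀ p v, J p (J p v) = -v
  gQ_J : ∀ p v w, gQ p (J p v) (J p w) = gQ p v w
  exists_chart : ∀ p : M,
    ∃ e : OpenPartialHomeomorph M (EuclideanSpace ℝ (Fin m) × EuclideanSpace ℂ (Fin n)),
      IsComplexFoliatedChart F J e ∧ p ∈ e.source ∧
      ∃ g : EuclideanSpace ℂ (Fin n) →
          EuclideanSpace ℂ (Fin n) →L[ℝ] EuclideanSpace ℂ (Fin n) →L[ℝ] ℝ,
        IsKaehlerMetricOn g (Prod.snd '' e.target) ∧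
        ∀ p' ∈ e.source, ∀ v w : TangentSpace 𝓘(ℝ, ManifoldModel m (2 * n)) p',
          gQ p' (F.toQ p' v) (F.toQ p' w)
            = g (transverseCoord e p') (dTransverse e p' v) (dTransverse e p' w)

/-- The matrix `∂²f / ∂z_k ∂z̄_l` at a point `a` of a real function of `(x, z) ∈ ℝ^m × ℂ^n`, with
`∂/∂z_k = (∂/∂a_k - i ∂/∂b_k) / 2`, `∂/∂z̄_l = (∂/∂a_l + i ∂/∂b_l) / 2` for `z = a + i b`. -/
def complexHessian {m n : ℕ}
    (f : EuclideanSpace ℝ (Fin m) × EuclideanSpace ℂ (Fin n) → ℝ)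
    (a : EuclideanSpace ℝ (Fin m) × EuclideanSpace ℂ (Fin n)) : Matrix (Fin n) (Fin n) ℂ :=
  let D (v w : EuclideanSpace ℂ (Fin n)) : ℂ := (fderiv ℝ (fderiv ℝ f) a (0, v) (0, w) : ℝ)
  let A (k : Fin n) : EuclideanSpace ℂ (Fin n) := EuclideanSpace.single k 1
  let B (k : Fin n) : EuclideanSpace ℂ (Fin n) := EuclideanSpace.single k Complex.I
  Matrix.of fun k l =>
    (D (A k) (A l) + D (B k) (B l) + Complex.I * (D (A k) (B l) - D (B k) (A l))) / 4

/-- `i ∂_B ∂̄_B u ≤ 0` at `p`: in complex foliated coordinates around `p`, the Hermitian matrix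
`∂²u / ∂z_k ∂z̄_l` is negative semidefinite at `p`. -/
def TransverseKaehler.IDDbarNonpos {m n : ℕ} {M : Type*} [TopologicalSpace M]
    [ChartedSpace (ManifoldModel m (2 * n)) M] {F : Foliation m (2 * n) M}
    (K : TransverseKaehler F) (u : F.basicFunctions) (p : M) : Prop :=
  ∀ e : OpenPartialHomeomorph M (EuclideanSpace ℝ (Fin m) × EuclideanSpace ℂ (Fin n)),
    IsComplexFoliatedChart F K.J e → p ∈ e.source →
      (-complexHessian ((u : M → ℝ) ∘ e.symm) (e p)).PosSemidef

/-- The interval `[0, ε)`, where `ε` may be `∞`. -/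
def timeInterval (ε : EReal) : Set ℝ := {t | 0 ≤ t ∧ (t : EReal) < ε}

/-- A smooth family, `t ∈ [0, ε)`, of linear basic partial differential operators of order `r`: in
foliated coordinates `(x, y)`, the operator at time `t` is
`u ↦ ∑_{k ≤ r} a^{i_1 … i_k}(y, t) ∂^k u / ∂y^{i_1} ⋯ ∂y^{i_k}`
with coefficients smooth in `(y, t)`. The values at `t ∉ [0, ε)` carry no meaning. -/
structure BasicOperatorFamily {m q : ℕ} {M : Type*} [TopologicalSpace M]
    [ChartedSpace (ManifoldModel m q) M] (F : Foliation m q M) (ε : EReal) (r : ℕ) where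
  op : ℝ → F.basicFunctions →ₗ[ℝ] F.basicFunctions
  coeff : OpenPartialHomeomorph M (EuclideanSpace ℝ (Fin m) × EuclideanSpace ℝ (Fin q)) →
    (k : ℕ) → (Fin k → Fin q) → EuclideanSpace ℝ (Fin q) × ℝ → ℝ
  coeff_smooth : ∀ e, IsFoliatedChart F.L e → ∀ k ≤ r, ∀ i : Fin k → Fin q,
    ContDiffOn ℝ ∞ (coeff e k i) ((Prod.snd '' e.target) ×ˢ timeInterval ε)
  local_expression : ∀ e, IsFoliatedChart F.L e → ∀ p ∈ e.source, ∀ t ∈ timeInterval ε,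
    ∀ u : F.basicFunctions,
      (op t u : M → ℝ) p =
        ∑ k ∈ Finset.range (r + 1), ∑ i : Fin k → Fin q,
          coeff e k i (transverseCoord e p, t) *
            iteratedFDeriv ℝ k ((u : M → ℝ) ∘ e.symm) (e p)
              (fun j => (0, EuclideanSpace.single (i j) (1 : ℝ)))

namespace BasicOperatorFamily

/-- The principal symbol `i^r ∑ a^{i_1 … i_r}(y, t) ξ_{i_1} ⋯ ξ_{i_r}` at `p` and time `t`, on the
covector `ξ = ∑ ξ_i dy^i` of `Q`, in foliated coordinates `(x, y)`. -/
def symbol {m q : ℕ} {M : Type*} [TopologicalSpace M] [ChartedSpace (ManifoldModel m q) M]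
    {F : Foliation m q M} {ε : EReal} {r : ℕ} (E : BasicOperatorFamily F ε r)
    (e : OpenPartialHomeomorph M (EuclideanSpace ℝ (Fin m) × EuclideanSpace ℝ (Fin q)))
    (p : M) (t : ℝ) (ξ : Fin q → ℝ) : ℂ :=
  Complex.I ^ r *
    ((∑ i : Fin r → Fin q, E.coeff e r i (transverseCoord e p, t) * ∏ j, ξ (i j) : ℝ) : ℂ)

/-- Transverse strong ellipticity at time `t`: the order `r` is even and there is `c > 0` with
`(-1)^{r/2} σ(p, ξ) ≥ c |ξ|^r` for all `p` and all `0 ≠ ξ ∈ Q_p^*`. Every `ξ` is written as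
`g_Q(w, ·)` with `w ∈ Q_p`, so that `|ξ|² = g_Q(w, w)`. -/
def IsStronglyElliptic {m n : ℕ} {M : Type*} [TopologicalSpace M]
    [ChartedSpace (ManifoldModel m (2 * n)) M] {F : Foliation m (2 * n) M} {ε : EReal} {r : ℕ}
    (E : BasicOperatorFamily F ε r) (K : TransverseKaehler F) (t : ℝ) : Prop :=
  Even r ∧ ∃ c : ℝ, 0 < c ∧
    ∀ e, IsFoliatedChart F.L e → ∀ p ∈ e.source, ∀ w : F.Q p, w ≠ 0 →
      ∀ ξ : Fin (2 * n) → ℝ,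
        (∀ v : TangentSpace 𝓘(ℝ, ManifoldModel m (2 * n)) p,
          K.gQ p w (F.toQ p v) = ∑ i, ξ i * (dTransverse e p v) i) →
        c * (K.gQ p w w) ^ (r / 2) ≤ ((-1) ^ (r / 2) * E.symbol e p t ξ).re

end BasicOperatorFamily

/-- `h ∈ C_B^∞(M × [0, ε))`: the functions `h t` are basic and `h` is jointly smooth on
`M × [0, ε)`. The values at `t ∉ [0, ε)` carry no meaning. -/
def IsSmoothBasicFamily {m q : ℕ} {M : Type*} [TopologicalSpace M]
    [ChartedSpace (ManifoldModel m q) M] {F : Foliation m q M} (ε : EReal)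
    (h : ℝ → F.basicFunctions) : Prop :=
  ContMDiffOn (𝓘(ℝ, ManifoldModel m q).prod 𝓘(ℝ, ℝ)) 𝓘(ℝ, ℝ) ∞
    (fun x : M × ℝ => (h x.2 : M → ℝ) x.1) (Set.univ ×ˢ timeInterval ε)

end

/-! The obstacle is that `∂_t h ≤ E(h)` is not strict, so a small multiple of time is subtracted.
Fix `τ < ε` and `δ > 0`. On the compact set `M × [0, τ]` the function `h - δ t` has a maximum `(p₀,
t₀)`. The term `δ t` is constant on each time slice, so `p₀` is a maximum of `h t₀` itself. There
the complex Hessian is negative semidefinite (`TransverseKaehler.iDDbarNonpos_of_isLocalMax`), hence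
`E(h) ≤ 0` and `∂_t h ≤ 0`. If `t₀ > 0`, maximality in time gives `∂_t h ≥ δ`
(`HasDerivWithinAt.nonneg_of_forall_le_right`), a contradiction. So `t₀ = 0`, and `δ → 0` gives the
bound.

The Hessian claim reduces to one variable: on a vector `x`, the complex Hessian is a quarter of the
sum of two real second derivatives, along `x̄` and `i x̄`. -/

/-- Second-order necessary condition at a local maximum, in one variable. -/
theorem IsLocalMax.deriv_deriv_nonpos {g : ℝ → ℝ} {x : ℝ} (hg : ContinuousAt g x)
    (hmax : IsLocalMax g x) : deriv (deriv g) x ≤ 0 := by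
  by_contra! hc
  -- A positive second derivative would make `x` a local minimum as well, so `g` would be locally
  -- constant and the second derivative zero.
  have hmin : IsLocalMin g x := isLocalMin_of_deriv_deriv_pos hc hmax.deriv_eq_zero hg
  have hconst : g =ᶠ[nhds x] fun _ => g x := by
    filter_upwards [hmax, hmin] with s h1 h2 using le_antisymm h1 h2
  have hd : deriv g =ᶠ[nhds x] fun _ => 0 := by simpa using hconst.deriv
  simp [hd.deriv_eq] at hc

/-- Second-order necessary condition at a local maximum. -/
theorem IsLocalMax.fderiv_fderiv_apply_self_nonpos {X : Type*} [NormedAddCommGroup X]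
    [NormedSpace ℝ X] {f : X → ℝ} {a : X} (hf : ContDiffAt ℝ 2 f a) (hmax : IsLocalMax f a)
    (v : X) : fderiv ℝ (fderiv ℝ f) a v v ≤ 0 := by
  have hline : ∀ s : ℝ, HasDerivAt (fun s : ℝ => a + s • v) v s := fun s => by
    simpa using ((hasDerivAt_id s).smul_const v).const_add a
  have h0 : a + (0 : ℝ) • v = a := by simp
  have hcont : Filter.Tendsto (fun s : ℝ => a + s • v) (nhds 0) (nhds a) := by
    simpa [h0] using (hline 0).continuousAt.tendsto
  have hd : ∀ᶠ b in nhds a, DifferentiableAt ℝ f b :=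
    (hf.eventually (by simp)).mono fun b hb => hb.differentiableAt (by simp)
  have hderiv : deriv (fun s : ℝ => f (a + s • v)) =ᶠ[nhds 0]
      fun s => fderiv ℝ f (a + s • v) v := by
    filter_upwards [hcont.eventually hd] with s hs
    exact (hs.hasFDerivAt.comp_hasDerivAt s (hline s)).deriv
  have hdd : deriv (deriv (fun s : ℝ => f (a + s • v))) 0 = fderiv ℝ (fderiv ℝ f) a v v := by
    rw [hderiv.deriv_eq]
    have h2 : DifferentiableAt ℝ (fderiv ℝ f) a :=
      (hf.fderiv_right (m := 1) (by norm_num)).differentiableAt (by simp)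
    have h3 : HasFDerivAt (fderiv ℝ f) (fderiv ℝ (fderiv ℝ f) a) (a + (0 : ℝ) • v) := by
      rw [h0]; exact h2.hasFDerivAt
    have h4 := h3.comp_hasDerivAt (0 : ℝ) (hline 0)
    exact (h4.clm_apply (hasDerivAt_const (0 : ℝ) v)).deriv.trans (by simp)
  rw [← hdd]
  refine IsLocalMax.deriv_deriv_nonpos ?_ ?_
  · exact ContinuousAt.comp (g := f) (by rw [h0]; exact hf.continuousAt) (hline 0).continuousAt
  · have := hcont.eventually hmax
    filter_upwards [this] with s hs
    simpa using hs

/-- The complex Hessian at a local maximum is negative semidefinite. -/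
theorem IsLocalMax.neg_complexHessian_posSemidef {m n : ℕ}
    {f : EuclideanSpace ℝ (Fin m) × EuclideanSpace ℂ (Fin n) → ℝ}
    {a : EuclideanSpace ℝ (Fin m) × EuclideanSpace ℂ (Fin n)}
    (hf : ContDiffAt ℝ 2 f a) (hmax : IsLocalMax f a) : (-complexHessian f a).PosSemidef := by
  set D := fderiv ℝ (fderiv ℝ f) a with hD
  have hsymm : ∀ v w, D v w = D w v := hf.isSymmSndFDerivAt (by simp)
  set A : Fin n → EuclideanSpace ℝ (Fin m) × EuclideanSpace ℂ (Fin n) :=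
    fun k => (0, EuclideanSpace.single k 1) with hA
  set B : Fin n → EuclideanSpace ℝ (Fin m) × EuclideanSpace ℂ (Fin n) :=
    fun k => (0, EuclideanSpace.single k Complex.I) with hB
  have hH : ∀ k l, complexHessian f a k l = ((D (A k) (A l) : ℂ) + (D (B k) (B l) : ℂ)
      + Complex.I * ((D (A k) (B l) : ℂ) - (D (B k) (A l) : ℂ))) / 4 := fun k l => rfl
  refine Matrix.PosSemidef.of_dotProduct_mulVec_nonneg ?_ fun x => ?_
  · ext k l
    simp only [Matrix.conjTranspose_apply, Matrix.neg_apply, hH, star_neg]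
    rw [hsymm (A l) (A k), hsymm (B l) (B k), hsymm (A l) (B k), hsymm (B l) (A k)]
    simp only [Complex.star_def, map_div₀, map_add, map_mul, map_sub, Complex.conj_ofReal,
      Complex.conj_I, map_ofNat]
    ring
  -- In complex terms `v = (0, x̄)` and `w = (0, i x̄)`; the conjugate appears because the row index
  -- `k`, which carries `∂/∂z_k`, is paired with `star x`.
  · set v := ∑ k, ((x k).re • A k - (x k).im • B k) with hv
    set w := ∑ k, ((x k).im • A k + (x k).re • B k) with hw
    have hvw : D v w = D w v := hsymm v w
    -- This identity uses only bilinearity of `D`; the imaginary cross term is cancelled afterwards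
    -- by the symmetry `hvw`.
    have key : star x ⬝ᵥ (-complexHessian f a).mulVec x =
        -(((D v v : ℝ) : ℂ) + ((D w w : ℝ) : ℂ)
          + Complex.I * (((D v w : ℝ) : ℂ) - ((D w v : ℝ) : ℂ))) / 4 := by
      simp only [hv, hw, map_sum, sum_apply, dotProduct, Matrix.mulVec,
        Matrix.neg_apply, hH, Finset.mul_sum, Complex.ofReal_sum, ← Finset.sum_sub_distrib,
        ← Finset.sum_add_distrib, Finset.sum_div, ← Finset.sum_neg_distrib]
      rw [Finset.sum_comm]
      refine Finset.sum_congr rfl fun l _ => Finset.sum_congr rfl fun k _ => ?_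
      have hx : star x k = ((x k).re : ℂ) - Complex.I * ((x k).im : ℂ) := by
        apply Complex.ext <;> simp
      rw [hx]
      have hxl : x l = ((x l).re : ℂ) + Complex.I * ((x l).im : ℂ) := by
        apply Complex.ext <;> simp
      simp only [map_add, map_sub, map_smul, add_apply, sub_apply, smul_apply, smul_eq_mul]
      push_cast
      generalize (x l).re = c at hxl ⊢
      generalize (x l).im = d at hxl ⊢
      rw [hxl]
      ring_nf
      simp only [Complex.I_sq, Complex.I_pow_three]
      ring
    rw [key, hvw]
    have h1 := hmax.fderiv_fderiv_apply_self_nonpos hf v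
    have h2 := hmax.fderiv_fderiv_apply_self_nonpos hf w
    have : -(((D v v : ℝ) : ℂ) + ((D w w : ℝ) : ℂ)
          + Complex.I * (((D w v : ℝ) : ℂ) - ((D w v : ℝ) : ℂ))) / 4
        = ((-(D v v + D w w) / 4 : ℝ) : ℂ) := by push_cast; ring
    rw [this]
    exact Complex.zero_le_real.mpr (by rw [← hD] at h1 h2; linarith)

/-- A basic function satisfies `i ∂_B ∂̄_B u ≤ 0` at its local maxima. -/
theorem TransverseKaehler.iDDbarNonpos_of_isLocalMax {m n : ℕ} {M : Type*} [TopologicalSpace M]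
    [ChartedSpace (ManifoldModel m (2 * n)) M] {F : Foliation m (2 * n) M}
    (K : TransverseKaehler F) (u : F.basicFunctions) {p : M}
    (hmax : IsLocalMax (u : M → ℝ) p) : K.IDDbarNonpos u p := by
  intro e he hp
  have hsm : ContDiffOn ℝ ∞ ((u : M → ℝ) ∘ e.symm) e.target := by
    rw [← contMDiffOn_iff_contDiffOn]
    exact u.2.1.comp_contMDiffOn he.foliated.smooth_symm
  refine IsLocalMax.neg_complexHessian_posSemidef
    ((hsm.contDiffAt (e.open_target.mem_nhds (e.map_source hp))).of_le ?_) ?_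
  · exact WithTop.coe_le_coe.mpr (le_top : (2 : ℕ∞) ≤ ⊤)
  · have hc := (e.continuousAt_symm (e.map_source hp)).tendsto
    rw [e.left_inv hp] at hc
    filter_upwards [hc.eventually hmax] with b hb
    simpa [e.left_inv hp] using hb

/-- The derivative from the left is nonnegative at a maximum over `[a, b]` attained at `b`. -/
theorem HasDerivWithinAt.nonneg_of_forall_le_right {f : ℝ → ℝ} {f' a b : ℝ} (hab : a < b)
    (hf : HasDerivWithinAt f f' (Set.Icc a b) b) (hmax : ∀ s ∈ Set.Icc a b, f s ≤ f b) :
    0 ≤ f' := by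
  have hloc : IsLocalMaxOn f (Set.Icc a b) b :=
    Filter.eventually_of_mem self_mem_nhdsWithin hmax
  -- The admissible direction at the right endpoint points backwards, so `(a - b) f' ≤ 0` with `a -
  -- b < 0`.
  have hcone : a - b ∈ posTangentConeAt (Set.Icc a b) b := by
    apply sub_mem_posTangentConeAt_of_segment_subset
    rw [segment_symm, segment_eq_Icc hab.le]
  have := hloc.hasFDerivWithinAt_nonpos hf.hasFDerivWithinAt hcone
  simp at this
  nlinarith

theorem mainTheorem8 {m n : ℕ} {M : Type*} [TopologicalSpace M] [T2Space M] [CompactSpace M]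
    [ChartedSpace (ManifoldModel m (2 * n)) M]
    [IsManifold 𝓘(ℝ, ManifoldModel m (2 * n)) ∞ M]
    (F : Foliation m (2 * n) M) (K : TransverseKaehler F)
    (ε : EReal) (hε : 0 < ε) (r : ℕ) (E : BasicOperatorFamily F ε r)
    (hE_elliptic : ∀ t ∈ timeInterval ε, E.IsStronglyElliptic K t)
    (hE : ∀ h : ℝ → F.basicFunctions, IsSmoothBasicFamily ε h →
      ∀ p : M, ∀ t ∈ timeInterval ε, K.IDDbarNonpos (h t) p → (E.op t (h t) : M → ℝ) p ≤ 0)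
    (h : ℝ → F.basicFunctions) (hh : IsSmoothBasicFamily ε h)
    (hsub : ∀ p : M, ∀ t ∈ timeInterval ε,
      derivWithin (fun s => (h s : M → ℝ) p) (timeInterval ε) t - (E.op t (h t) : M → ℝ) p ≤ 0) :
    (⨆ p : M, ⨆ t ∈ timeInterval ε, (((h t : M → ℝ) p : ℝ) : EReal))
      ≤ ⨆ p : M, (((h 0 : M → ℝ) p : ℝ) : EReal) := by
  refine iSup_le fun p => iSup₂_le fun τ hτ => ?_
  have hIcc : Set.Icc 0 τ ⊆ timeInterval ε := fun s hs =>
    ⟨hs.1, lt_of_le_of_lt (EReal.coe_le_coe_iff.mpr hs.2) hτ.2⟩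
  have hcontM : ContinuousOn (fun x : M × ℝ => (h x.2 : M → ℝ) x.1)
      (Set.univ ×ˢ Set.Icc 0 τ) :=
    hh.continuousOn.mono (Set.prod_mono le_rfl hIcc)
  -- the maximum of `h - δ t` over `M × [0, τ]` is attained at `t = 0`
  have hδ : ∀ δ : ℝ, 0 < δ → ∃ p₀ : M, (h τ : M → ℝ) p - δ * τ ≤ (h 0 : M → ℝ) p₀ := by
    intro δ hδ
    obtain ⟨⟨p₀, t₀⟩, ⟨-, ht₀⟩, hmax⟩ :=
      (isCompact_univ.prod isCompact_Icc).exists_isMaxOn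
        ⟨(p, τ), Set.mem_univ _, Set.right_mem_Icc.mpr hτ.1⟩
        (hcontM.sub (f := fun x : M × ℝ => (h x.2 : M → ℝ) x.1) (g := fun x : M × ℝ => δ * x.2)
          (by fun_prop))
    have hle : ∀ p' : M, ∀ s ∈ Set.Icc 0 τ,
        (h s : M → ℝ) p' - δ * s ≤ (h t₀ : M → ℝ) p₀ - δ * t₀ :=
      fun p' s hs => hmax (show (p', s) ∈ Set.univ ×ˢ Set.Icc 0 τ from ⟨Set.mem_univ _, hs⟩)
    change t₀ ∈ Set.Icc 0 τ at ht₀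
    rcases ht₀.1.eq_or_lt with h0 | hpos
    · refine ⟨p₀, ?_⟩
      have := hle p τ (Set.right_mem_Icc.mpr hτ.1)
      rw [← h0] at this
      simpa using this
    · exfalso
      have hlocal : IsLocalMax (h t₀ : M → ℝ) p₀ :=
        Filter.Eventually.of_forall fun p' => by simpa using hle p' t₀ ht₀
      have hEle := hE h hh p₀ t₀ (hIcc ht₀) (K.iDDbarNonpos_of_isLocalMax _ hlocal)
      -- Differentiability makes the `derivWithin` of `hsub` a true derivative. It is then
      -- restricted to `[0, t₀]`, because `t₀` may equal `τ` and only comparison with earlier times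
      -- is available.
      have hdiff : DifferentiableWithinAt ℝ (fun s => (h s : M → ℝ) p₀) (timeInterval ε) t₀ := by
        have hc : ContMDiffOn 𝓘(ℝ, ℝ) 𝓘(ℝ, ℝ) ∞ (fun s : ℝ => (h s : M → ℝ) p₀)
            (timeInterval ε) :=
          ContMDiffOn.comp hh (f := fun s : ℝ => (p₀, s))
            (contMDiff_const.prodMk contMDiff_id).contMDiffOn
            fun s hs => ⟨Set.mem_univ _, hs⟩
        exact hc.contDiffOn.differentiableOn (by simp) t₀ (hIcc ht₀)
      have hder := (hdiff.hasDerivWithinAt.mono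
        ((Set.Icc_subset_Icc le_rfl ht₀.2).trans hIcc)).sub
          (((hasDerivAt_id t₀).const_mul δ).hasDerivWithinAt (s := Set.Icc 0 t₀))
      have hnn := hder.nonneg_of_forall_le_right hpos fun s hs =>
        hle p₀ s ⟨hs.1, hs.2.trans ht₀.2⟩
      have := hsub p₀ t₀ (hIcc ht₀)
      linarith
  -- The supremum of `h 0` is attained, which turns the `EReal` inequality into a real one.
  obtain ⟨pm, -, hpm⟩ := isCompact_univ.exists_isMaxOn ⟨p, Set.mem_univ p⟩
    (h 0).2.1.continuous.continuousOn
  refine le_trans (EReal.coe_le_coe_iff.mpr ?_)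
    (le_iSup (fun p : M => (((h 0 : M → ℝ) p : ℝ) : EReal)) pm)
  refine le_of_forall_pos_le_add fun η hη => ?_
  have hτ1 : 0 < τ + 1 := by linarith [hτ.1]
  -- Dividing by `τ + 1` instead of `τ` covers `τ = 0` and still gives `δ τ ≤ η`.
  obtain ⟨p₀, hp₀⟩ := hδ (η / (τ + 1)) (div_pos hη hτ1)
  have h1 : (h 0 : M → ℝ) p₀ ≤ (h 0 : M → ℝ) pm := hpm (Set.mem_univ p₀)
  have h2 : η / (τ + 1) * τ ≤ η := by
    rw [div_mul_eq_mul_div, div_le_iff₀ hτ1]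
    nlinarith
  linarith
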